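/- Let $t_0\in\mathbb{R}$ and let $a_{11},a_{12},a_{21},a_{22}$ be real-valued continuous functions on $[t_0,\infty)$. Consider the linear system $$\phi' = a_{11}(t)\phi + a_{12}(t)\psi,\qquad \psi' = a_{21}(t)\phi + a_{22}(t)\psi,\qquad t\ge t_0. \tag{1.1}$$ Assume that the supports of $a_{12}$ and $a_{21}$ are unbounded (that is, each of these functions takes nonzero values at arbitrarily large $t$), and that $a_{12}(t)\ge 0$ and $a_{21}(t)\ge 0$ for all $t\ge t_0$. Then (1.1) satisfies the non-conjugation condition on $[t_0,\infty)$: for every real-valued solution $(\phi,\psi)$ of (1.1) on $[t_0,\infty)$ that is not identically zero, each of the zero sets $\{t\ge t_0:\phi(t)=0\}$ and $\{t\ge t_0:\psi(t)=0\}$ is either empty or a segment $[a,b]$ with $t_0\le a\le b<\infty$ (possibly degenerate, $a=b$). -/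

import Mathlib

/-- `(φ, ψ)` is a (real-valued, classical) solution on `[t₀, ∞)` of the linear system
`φ' = a₁₁ φ + a₁₂ ψ`, `ψ' = a₂₁ φ + a₂₂ ψ`; the derivative at `t₀` is one-sided. -/
def IsSystemSolution (a₁₁ a₁₂ a₂₁ a₂₂ : ℝ → ℝ) (t₀ : ℝ) (φ ψ : ℝ → ℝ) : Prop :=
  ∀ t ∈ Set.Ici t₀,
    HasDerivWithinAt φ (a₁₁ t * φ t + a₁₂ t * ψ t) (Set.Ici t₀) t ∧
    HasDerivWithinAt ψ (a₂₁ t * φ t + a₂₂ t * ψ t) (Set.Ici t₀) t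

/-- The pair `(φ, ψ)` is not identically `(0, 0)` on `[t₀, ∞)`. -/
def IsNontrivialOn (t₀ : ℝ) (φ ψ : ℝ → ℝ) : Prop :=
  ∃ t ∈ Set.Ici t₀, φ t ≠ 0 ∨ ψ t ≠ 0

/-- `u` vanishes no more than one time on `[t₁, ∞)`: it has no zeros there, or the set of its zeros
there is a compact segment `[a, b]`, possibly a single point (`a = b`). -/
def VanishesAtMostOnceOn (t₁ : ℝ) (u : ℝ → ℝ) : Prop :=
  {t ∈ Set.Ici t₁ | u t = 0} = ∅ ∨
    ∃ a b : ℝ, a ≤ b ∧ {t ∈ Set.Ici t₁ | u t = 0} = Set.Icc a b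

/-- The system on `[t₀, ∞)` satisfies the non-conjugation condition on `[t₁, ∞)` (`t₁ ≥ t₀`):
both components of every nontrivial solution vanish no more than one time on `[t₁, ∞)`. -/
def NonConjugationCondition (a₁₁ a₁₂ a₂₁ a₂₂ : ℝ → ℝ) (t₀ t₁ : ℝ) : Prop :=
  ∀ φ ψ : ℝ → ℝ, IsSystemSolution a₁₁ a₁₂ a₂₁ a₂₂ t₀ φ ψ → IsNontrivialOn t₀ φ ψ →
    VanishesAtMostOnceOn t₁ φ ∧ VanishesAtMostOnceOn t₁ ψ

/-- The function `u` on `[t₀, ∞)` has unbounded support. -/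
def HasUnboundedSupportOn (t₀ : ℝ) (u : ℝ → ℝ) : Prop :=
  ¬ BddAbove {t ∈ Set.Ici t₀ | u t ≠ 0}

open Set

/-! Scaling by positive integrating factors, `u = φ exp (-∫ a₁₁)` and `v = ψ exp (-∫ a₂₂)`, removes
the diagonal and preserves zeros, signs and supports: `u' = b v`, `v' = c u` with `b, c ≥ 0`. Then
`(u v)' = b v² + c u² ≥ 0`. Between two zeros of `u` the monotone product `u v` is therefore
identically zero, so `b v² = 0`, hence `u' = b v = 0` and `u` stays zero
(`offDiagonal_eq_zero_between`). If the zeros were unbounded, `u` would vanish on a ray; at a point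
of it where `b ≠ 0` also `v = 0`, and uniqueness (`offDiagonal_eq_zero_of_eq_zero`) would make the
solution trivial. -/

/-- A continuous function on `[t₀, ∞)` has a primitive there. -/
lemma exists_primitive_on_Ici {t₀ : ℝ} {a : ℝ → ℝ} (ha : ContinuousOn a (Ici t₀)) :
    ∃ A : ℝ → ℝ, Continuous A ∧ ∀ t ∈ Ici t₀, HasDerivWithinAt A (a t) (Ici t₀) t := by
  have hc : Continuous (fun t => a (max t t₀)) :=
    ha.comp_continuous (by fun_prop) fun t => le_max_right t t₀
  have hd (t : ℝ) : HasDerivAt (fun t => ∫ s in t₀..t, a (max s t₀)) (a (max t t₀)) t :=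
    intervalIntegral.integral_hasDerivAt_right (hc.intervalIntegrable _ _)
      hc.stronglyMeasurable.stronglyMeasurableAtFilter hc.continuousAt
  refine ⟨_, continuous_iff_continuousAt.2 fun t => (hd t).continuousAt, fun t ht => ?_⟩
  have h := (hd t).hasDerivWithinAt (s := Ici t₀)
  rwa [max_eq_left (mem_Ici.1 ht)] at h

lemma monotoneOn_Ici_of_hasDerivWithinAt_nonneg {t₀ : ℝ} {f f' : ℝ → ℝ}
    (hf : ∀ t ∈ Ici t₀, HasDerivWithinAt f (f' t) (Ici t₀) t)
    (hf' : ∀ t ∈ Ici t₀, 0 ≤ f' t) : MonotoneOn f (Ici t₀) :=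
  monotoneOn_of_hasDerivWithinAt_nonneg (convex_Ici t₀)
    (fun t ht => (hf t ht).continuousWithinAt)
    (fun t ht => (hf t (interior_subset ht)).mono interior_subset)
    fun t ht => hf' t (interior_subset ht)

/-- A function vanishing on a nondegenerate segment has vanishing derivative there. -/
lemma HasDerivWithinAt.eq_zero_of_eqOn_Icc {t₀ p q t f' : ℝ} {f : ℝ → ℝ}
    (hp : t₀ ≤ p) (hpq : p < q) (ht : t ∈ Icc p q) (hf : HasDerivWithinAt f f' (Ici t₀) t)
    (h0 : ∀ s ∈ Icc p q, f s = 0) : f' = 0 :=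
  (uniqueDiffOn_Icc hpq t ht).eq_deriv _ (hf.mono fun _ hs => hp.trans hs.1)
    ((hasDerivWithinAt_const t (Icc p q) (0 : ℝ)).congr h0 (h0 t ht))

section OffDiagonal

variable {t₀ : ℝ} {b c u v : ℝ → ℝ}
  (hu : ∀ t ∈ Ici t₀, HasDerivWithinAt u (b t * v t) (Ici t₀) t)
  (hv : ∀ t ∈ Ici t₀, HasDerivWithinAt v (c t * u t) (Ici t₀) t)
  (hb : ∀ t ∈ Ici t₀, 0 ≤ b t) (hc : ∀ t ∈ Ici t₀, 0 ≤ c t)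

include hu hv hb hc

/-- A solution of `u' = b v`, `v' = c u` with `b, c ≥ 0` that vanishes at one point is trivial. -/
lemma offDiagonal_eq_zero_of_eq_zero
    (hbc : ContinuousOn b (Ici t₀)) (hcc : ContinuousOn c (Ici t₀))
    {s : ℝ} (hs : s ∈ Ici t₀) (hus : u s = 0) (hvs : v s = 0) :
    ∀ t ∈ Ici t₀, u t = 0 ∧ v t = 0 := by
  obtain ⟨B, -, hB⟩ := exists_primitive_on_Ici (hbc.add hcc)
  -- As `(u² + v²)' = 2 (b + c) u v`, the weights `exp (±B)` complete the squares `(b + c) (u ±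
  -- v)²`. The weight `exp B` handles times before `s`, `exp (-B)` times after.
  have up : MonotoneOn (fun t => (u t ^ 2 + v t ^ 2) * Real.exp (B t)) (Ici t₀) := by
    refine monotoneOn_Ici_of_hasDerivWithinAt_nonneg
      (f' := fun t => (b t + c t) * (u t + v t) ^ 2 * Real.exp (B t)) (fun t ht => ?_) fun t ht => ?_
    · refine HasDerivWithinAt.congr_deriv ((((hu t ht).pow 2).add ((hv t ht).pow 2)).mul (hB t ht).exp) ?_
      simp only [Pi.add_apply, Pi.pow_apply]; push_cast; ring
    · have := hb t ht
      have := hc t ht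
      positivity
  have down : MonotoneOn (fun t => -((u t ^ 2 + v t ^ 2) * Real.exp (-B t))) (Ici t₀) := by
    refine monotoneOn_Ici_of_hasDerivWithinAt_nonneg
      (f' := fun t => (b t + c t) * (u t - v t) ^ 2 * Real.exp (-B t)) (fun t ht => ?_)
      fun t ht => ?_
    · refine HasDerivWithinAt.congr_deriv (((((hu t ht).pow 2).add ((hv t ht).pow 2)).mul (hB t ht).neg.exp).neg) ?_
      simp only [Pi.add_apply, Pi.pow_apply, Pi.neg_apply]; push_cast; ring
    · have := hb t ht
      have := hc t ht
      positivity
  intro t ht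
  have key : u t ^ 2 + v t ^ 2 ≤ 0 := by
    rcases le_total t s with h | h
    · have := up ht hs h
      simp only [hus, hvs] at this
      exact nonpos_of_mul_nonpos_left (by simpa using this) (Real.exp_pos (B t))
    · have := down hs ht h
      simp only [hus, hvs] at this
      exact nonpos_of_mul_nonpos_left (by simpa using this) (Real.exp_pos (-B t))
  constructor <;> nlinarith [sq_nonneg (u t), sq_nonneg (v t)]

/-- The zero set of `u` is order-connected, since the product `u v` is monotone. -/
lemma offDiagonal_eq_zero_between {p q : ℝ} (hp : t₀ ≤ p) (hup : u p = 0) (huq : u q = 0) :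
    ∀ t ∈ Icc p q, u t = 0 := by
  intro t ht
  rcases (ht.1.trans ht.2).eq_or_lt with rfl | hpq
  · rwa [le_antisymm ht.2 ht.1]
  have hsub (s : ℝ) (hs : s ∈ Icc p q) : s ∈ Ici t₀ := hp.trans hs.1
  have hd (s : ℝ) (hs : s ∈ Ici t₀) :
      HasDerivWithinAt (fun t => u t * v t) (b s * v s ^ 2 + c s * u s ^ 2) (Ici t₀) s := by
    refine HasDerivWithinAt.congr_deriv ((hu s hs).mul (hv s hs)) ?_; ring
  have hnn (s : ℝ) (hs : s ∈ Ici t₀) : 0 ≤ b s * v s ^ 2 + c s * u s ^ 2 := by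
    have := hb s hs
    have := hc s hs
    positivity
  have hm := monotoneOn_Ici_of_hasDerivWithinAt_nonneg hd hnn
  have hprod (s : ℝ) (hs : s ∈ Icc p q) : u s * v s = 0 := by
    have h1 := hm hp (hsub s hs) hs.1
    have h2 := hm (hsub s hs) (hp.trans hpq.le) hs.2
    simp only [hup, huq, zero_mul] at h1 h2
    exact le_antisymm h2 h1
  have hbv (s : ℝ) (hs : s ∈ Icc p q) : b s * v s = 0 := by
    -- The derivative of `u v` vanishes on the segment and is a sum of two nonnegative terms, so
    -- each term is zero.
    have h := (hd s (hsub s hs)).eq_zero_of_eqOn_Icc hp hpq hs hprod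
    have h1 : b s * v s ^ 2 = 0 := by
      have := mul_nonneg (hb s (hsub s hs)) (sq_nonneg (v s))
      have := mul_nonneg (hc s (hsub s hs)) (sq_nonneg (u s))
      linarith
    rcases mul_eq_zero.1 h1 with h | h
    · simp [h]
    · simp [pow_eq_zero_iff two_ne_zero |>.1 h]
  rw [constant_of_has_deriv_right_zero
    (fun s hs => ((hu s (hsub s hs)).continuousWithinAt).mono hsub)
    (fun s hs => by
      have h := (hu s (hp.trans hs.1)).mono (Ici_subset_Ici.2 (hp.trans hs.1))
      rwa [hbv s ⟨hs.1, hs.2.le⟩] at h) t ht, hup]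

lemma offDiagonal_vanishesAtMostOnceOn
    (hbc : ContinuousOn b (Ici t₀)) (hcc : ContinuousOn c (Ici t₀))
    (hbs : HasUnboundedSupportOn t₀ b) (hne : IsNontrivialOn t₀ u v) :
    VanishesAtMostOnceOn t₀ u := by
  rcases eq_empty_or_nonempty {t ∈ Ici t₀ | u t = 0} with h | hZ
  · exact Or.inl h
  right
  set Z := {t ∈ Ici t₀ | u t = 0} with hZdef
  have hclosed : IsClosed Z :=
    ContinuousOn.preimage_isClosed_of_isClosed (fun t ht => (hu t ht).continuousWithinAt)
      isClosed_Ici (isClosed_singleton (x := (0 : ℝ)))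
  have hbelow : BddBelow Z := ⟨t₀, fun t ht => ht.1⟩
  have habove : BddAbove Z := by
    by_contra hunb
    obtain ⟨p, hp⟩ := hZ
    have hzero (t : ℝ) (ht : p ≤ t) : u t = 0 := by
      obtain ⟨q, hq, htq⟩ := not_bddAbove_iff.1 hunb t
      exact offDiagonal_eq_zero_between hu hv hb hc hp.1 hp.2 hq.2 t ⟨ht, htq.le⟩
    -- Strictness of `p < r` makes `[p, r]` nondegenerate, so `u = 0` on it determines the
    -- derivative `b r * v r` at its endpoint.
    obtain ⟨r, ⟨hr, hbr⟩, hpr⟩ := not_bddAbove_iff.1 hbs p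
    have hbv : b r * v r = 0 :=
      (hu r hr).eq_zero_of_eqOn_Icc hp.1 hpr ⟨hpr.le, le_rfl⟩ fun s hs => hzero s hs.1
    obtain ⟨t, ht, h⟩ := hne
    have := offDiagonal_eq_zero_of_eq_zero hu hv hb hc hbc hcc hr (hzero r hpr.le)
      ((mul_eq_zero.1 hbv).resolve_left hbr) t ht
    tauto
  refine ⟨sInf Z, sSup Z, csInf_le_csSup hZ hbelow habove, ?_⟩
  have ha := hclosed.csInf_mem hZ hbelow
  have hb' := hclosed.csSup_mem hZ habove
  ext t
  exact ⟨fun ht => ⟨csInf_le hbelow ht, le_csSup habove ht⟩, fun ht => ⟨ha.1.trans ht.1,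
    offDiagonal_eq_zero_between hu hv hb hc ha.1 ha.2 hb'.2 t ht⟩⟩

end OffDiagonal

lemma vanishesAtMostOnceOn_mul_exp {t₀ : ℝ} {u A : ℝ → ℝ} :
    VanishesAtMostOnceOn t₀ (fun t => u t * Real.exp (A t)) ↔ VanishesAtMostOnceOn t₀ u := by
  simp [VanishesAtMostOnceOn]

lemma HasUnboundedSupportOn.mul_exp {t₀ : ℝ} {a A : ℝ → ℝ} (h : HasUnboundedSupportOn t₀ a) :
    HasUnboundedSupportOn t₀ (fun t => a t * Real.exp (A t)) := by
  simpa [HasUnboundedSupportOn] using h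

theorem theorem3p7 (t₀ : ℝ) (a₁₁ a₁₂ a₂₁ a₂₂ : ℝ → ℝ)
    (h₁₁ : ContinuousOn a₁₁ (Set.Ici t₀)) (h₁₂ : ContinuousOn a₁₂ (Set.Ici t₀))
    (h₂₁ : ContinuousOn a₂₁ (Set.Ici t₀)) (h₂₂ : ContinuousOn a₂₂ (Set.Ici t₀))
    (hs₁₂ : HasUnboundedSupportOn t₀ a₁₂) (hs₂₁ : HasUnboundedSupportOn t₀ a₂₁)
    (hn₁₂ : ∀ t ∈ Set.Ici t₀, 0 ≤ a₁₂ t) (hn₂₁ : ∀ t ∈ Set.Ici t₀, 0 ≤ a₂₁ t) :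
    NonConjugationCondition a₁₁ a₁₂ a₂₁ a₂₂ t₀ t₀ := by
  intro φ ψ hsol hne
  obtain ⟨A, hAc, hA⟩ := exists_primitive_on_Ici h₁₁
  obtain ⟨D, hDc, hD⟩ := exists_primitive_on_Ici h₂₂
  -- The factor `exp (D - A)` arises from writing `ψ` as `v * exp D`.
  have hu (t : ℝ) (ht : t ∈ Ici t₀) : HasDerivWithinAt (fun t => φ t * Real.exp (-A t))
      (a₁₂ t * Real.exp (D t - A t) * (ψ t * Real.exp (-D t))) (Ici t₀) t := by
    refine HasDerivWithinAt.congr_deriv ((hsol t ht).1.mul (hA t ht).neg.exp) ?_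
    simp only [Pi.neg_apply, sub_eq_add_neg, Real.exp_add, Real.exp_neg]
    field_simp
    ring
  have hv (t : ℝ) (ht : t ∈ Ici t₀) : HasDerivWithinAt (fun t => ψ t * Real.exp (-D t))
      (a₂₁ t * Real.exp (A t - D t) * (φ t * Real.exp (-A t))) (Ici t₀) t := by
    refine HasDerivWithinAt.congr_deriv ((hsol t ht).2.mul (hD t ht).neg.exp) ?_
    simp only [Pi.neg_apply, sub_eq_add_neg, Real.exp_add, Real.exp_neg]
    field_simp
    ring
  have hb (t : ℝ) (ht : t ∈ Ici t₀) : 0 ≤ a₁₂ t * Real.exp (D t - A t) :=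
    mul_nonneg (hn₁₂ t ht) (Real.exp_pos _).le
  have hc (t : ℝ) (ht : t ∈ Ici t₀) : 0 ≤ a₂₁ t * Real.exp (A t - D t) :=
    mul_nonneg (hn₂₁ t ht) (Real.exp_pos _).le
  have hbc : ContinuousOn (fun t => a₁₂ t * Real.exp (D t - A t)) (Ici t₀) :=
    h₁₂.mul (by fun_prop)
  have hcc : ContinuousOn (fun t => a₂₁ t * Real.exp (A t - D t)) (Ici t₀) :=
    h₂₁.mul (by fun_prop)
  obtain ⟨s, hs, h⟩ := hne
  exact ⟨vanishesAtMostOnceOn_mul_exp.1 <| offDiagonal_vanishesAtMostOnceOn hu hv hb hc hbc hcc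
      hs₁₂.mul_exp ⟨s, hs, by simpa using h⟩,
    -- The reduced system is symmetric under exchanging `(u, b)` with `(v, c)`.
    vanishesAtMostOnceOn_mul_exp.1 <| offDiagonal_vanishesAtMostOnceOn hv hu hc hb hcc hbc
      hs₂₁.mul_exp ⟨s, hs, by simpa using h.symm⟩⟩
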